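/- Let $r\ge 1$. In $\mathbb{R}^{r+1}$ with standard basis $e_1,\dots,e_{r+1}$ put $\alpha_k=e_k-e_{k+1}$ and $\alpha_{i,j}=\alpha_i+\alpha_{i+1}+\cdots+\alpha_j$ for $1\le i\le j\le r$; the $\alpha_{i,j}$ are the positive roots of the Lie algebra $\mathfrak{sl}_{r+1}(\mathbb{C})$ of type $A_r$. Let $\tilde\alpha=\alpha_{1,r}$ be the highest root, $\rho$ half the sum of the positive roots, and $W$ the Weyl group, generated by the reflections in the hyperplanes orthogonal to $\alpha_1,\dots,\alpha_r$. Let $\wp$ be Kostant's partition function: $\wp(\xi)$ is the number of ways to write $\xi$ as a linear combination of the positive roots with nonnegative integer coefficients. The Weyl alternation set of weights $\lambda,\mu$ is $$\mathcal{A}_r(\lambda,\mu)=\{\sigma\in W : \wp(\sigma(\lambda+\rho)-\mu-\rho)>0\}.$$ **Theorem.** In the field of fractions of the formal power series ring $\mathbb{Z}[[x,s,t]]$, $$\sum_{1\le i\le j\le r}|\mathcal{A}_r(\tilde\alpha,-\alpha_{i,j})|\,x^r s^i t^j=\frac{1}{t(1-x-x^2)}\left((1-x)\,t\,\mathcal{H}(xt,s)+\mathcal{P}(xt,s)-\frac{xst}{1-xst-(xst)^2}\right),$$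 where the sum runs over all triples of integers $(r,i,j)$ with $1\le i\le j\le r$, and $$\mathcal{H}(x,s)=\frac{xs\,(x^4s+2x^3s-x^2s+xs+x^2+2x+1)}{(1-x-x^2-3x^3-x^4)(1-xs-(xs)^2)},\qquad \mathcal{P}(x,s)=\frac{xs\,(x^4s+3x^3s+x+1)}{(1-x-x^2-3x^3-x^4)(1-xs-(xs)^2)}.$$ -/

import Mathlib

noncomputable section

namespace TypeA

/-- The Euclidean space `ℝ^(r+1)` in which the weights of the Lie algebra of type `A_r` live. -/
abbrev E (r : ℕ) : Type := EuclideanSpace ℝ (Fin (r + 1))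

/-- The simple root `e_k - e_{k+1}`. The index `k : Fin r` is zero-based: the simple root that is
usually written `α_m`, with `1 ≤ m ≤ r`, is `simpleRoot r k` where `(k : ℕ) + 1 = m`. -/
def simpleRoot (r : ℕ) (k : Fin r) : E r :=
  EuclideanSpace.single k.castSucc 1 - EuclideanSpace.single k.succ 1

/-- `α_{i,j} = α_i + α_{i+1} + ⋯ + α_j`, with one-based indices `1 ≤ i ≤ j ≤ r`. -/
def root (r i j : ℕ) : E r :=
  ∑ k ∈ (Finset.univ : Finset (Fin r)).filter (fun k => i ≤ k.val + 1 ∧ k.val + 1 ≤ j),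
    simpleRoot r k

open Classical in
/-- The set of positive roots `α_{i,j}`, `1 ≤ i ≤ j ≤ r`. -/
def positiveRoots (r : ℕ) : Finset (E r) :=
  ((Finset.Icc 1 r ×ˢ Finset.Icc 1 r).filter (fun p => p.1 ≤ p.2)).image
    (fun p => root r p.1 p.2)

/-- The highest root `α̃ = α_1 + ⋯ + α_r`. -/
def highestRoot (r : ℕ) : E r := root r 1 r

/-- `ρ`, half the sum of the positive roots. -/
def rho (r : ℕ) : E r := (1 / 2 : ℝ) • ∑ β ∈ positiveRoots r, β

/-- The simple reflection in the hyperplane orthogonal to a simple root. -/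
def simpleReflection (r : ℕ) (k : Fin r) : E r ≃ₗᵢ[ℝ] E r :=
  (Submodule.span ℝ {simpleRoot r k})ᗮ.reflection

/-- The Weyl group of type `A_r`, generated by the simple reflections. -/
def weylGroup (r : ℕ) : Subgroup (E r ≃ₗᵢ[ℝ] E r) :=
  Subgroup.closure (Set.range (simpleReflection r))

/-- Kostant's partition function: the number of ways to write `ξ` as a linear combination of the
positive roots with nonnegative integer coefficients. -/
def kostantPartition (r : ℕ) (ξ : E r) : ℕ :=
  Nat.card {c : positiveRoots r → ℕ // ∑ β : positiveRoots r, c β • (β : E r) = ξ}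

/-- The Weyl alternation set `A_r(lam, mu)`. -/
def alternationSet (r : ℕ) (lam mu : E r) : Set (weylGroup r) :=
  {σ | 0 < kostantPartition r ((σ : E r ≃ₗᵢ[ℝ] E r) (lam + rho r) - mu - rho r)}

/-- The formal power series `∑_{1 ≤ i ≤ j ≤ r} |A_r(α̃, -α_{i,j})| x^r s^i t^j`. The variables
`x`, `s`, `t` have the indices `0`, `1`, `2`, so a monomial `n` has exponents `r = n 0`, `i = n 1`,
`j = n 2`. -/
def alternationSeries : MvPowerSeries (Fin 3) ℤ := fun n =>
  if 1 ≤ n 1 ∧ n 1 ≤ n 2 ∧ n 2 ≤ n 0 then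
    ((alternationSet (n 0) (highestRoot (n 0)) (-root (n 0) (n 1) (n 2))).ncard : ℤ)
  else 0

/-- The rational function `H(x, s)`. -/
def ratH {K : Type*} [Field K] (x s : K) : K :=
  x * s * (x ^ 4 * s + 2 * x ^ 3 * s - x ^ 2 * s + x * s + x ^ 2 + 2 * x + 1) /
    ((1 - x - x ^ 2 - 3 * x ^ 3 - x ^ 4) * (1 - x * s - (x * s) ^ 2))

/-- The rational function `P(x, s)`. -/
def ratP {K : Type*} [Field K] (x s : K) : K :=
  x * s * (x ^ 4 * s + 3 * x ^ 3 * s + x + 1) /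
    ((1 - x - x ^ 2 - 3 * x ^ 3 - x ^ 4) * (1 - x * s - (x * s) ^ 2))

/-- The field of fractions of the ring of formal power series `ℤ[[x, s, t]]`, in which both sides
of the identity live: the right-hand side has the factor `1 / t`. All denominators that occur are
nonzero in it. -/
abbrev SeriesField : Type := FractionRing (MvPowerSeries (Fin 3) ℤ)

/-- The variable with index `v`, as an element of the field of fractions. -/
def var (v : Fin 3) : SeriesField :=
  algebraMap (MvPowerSeries (Fin 3) ℤ) SeriesField (MvPowerSeries.X v)

end TypeA

end

/-! A vector of coordinate sum zero is the combination of simple roots whose coefficients are its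
partial sums, and every positive root has nonnegative partial sums. So, for integral partial sums,
Kostant's function is positive exactly when they are all nonnegative (`kostantPartition_pos_iff`).
Since W acts as the symmetric group on coordinates, the alternation set becomes a set of words
without repetition in the values 0, …, r whose running excess `∑ (weight - position)` stays ≤ 0, and
≤ 1 at the lengths from i to j (`permHom_mem_iff`).

Read such a word from left to right. The set of values used determines the excess, and the bound
leaves only four shapes for this set. Outside the window from i to j, only swaps of neighbouring
values survive, which gives Fibonacci numbers; inside it, a 4-state transfer matrix governs the
count (`counts_eq_middleCounts`). As a function of k = i - 1, p = j - i and q = r - j, the count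
thus obeys the Fibonacci recurrence in k and in q, and in p a recurrence with characteristic
polynomial λ⁴ - λ³ - λ² - 3λ - 1. Its generating function in xst, xt and x is therefore rational,
with a denominator of three factors and a numerator fixed by 2·2·4 initial values
(`mul_alternationSeries`). -/

open Finset

namespace TypeA

/-! ### Partial sums of coordinates -/

/-- The sum of the first `m` coordinates, as a linear form. -/
noncomputable def partialSum (r m : ℕ) : E r →ₗ[ℝ] ℝ :=
  ∑ k : Fin (r + 1) with k.val < m, (EuclideanSpace.proj (𝕜 := ℝ) k).toLinearMap

theorem partialSum_apply {r : ℕ} (m : ℕ) (v : E r) :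
    partialSum r m v = ∑ k : Fin (r + 1) with k.val < m, v k := by
  simp [partialSum, LinearMap.sum_apply]

theorem partialSum_single {r : ℕ} (m : ℕ) (c : Fin (r + 1)) :
    partialSum r m (EuclideanSpace.single c 1) = if c.val < m then 1 else 0 := by
  simp [partialSum_apply, PiLp.single_apply]

theorem partialSum_simpleRoot {r : ℕ} (m : ℕ) (k : Fin r) :
    partialSum r m (simpleRoot r k) = if k.val + 1 = m then 1 else 0 := by
  rw [simpleRoot, map_sub, partialSum_single, partialSum_single]
  simp only [Fin.val_castSucc, Fin.val_succ]
  split_ifs <;> first | omega | norm_num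

theorem partialSum_root {r i j : ℕ} (hi : 1 ≤ i) (hj : j ≤ r) (m : ℕ) :
    partialSum r m (root r i j) = if i ≤ m ∧ m ≤ j then 1 else 0 := by
  rw [root, map_sum]
  simp only [partialSum_simpleRoot]
  split_ifs with h
  · rw [Finset.sum_eq_single_of_mem (⟨m - 1, by omega⟩ : Fin r)]
    · rw [if_pos (by simp; omega)]
    · simp; omega
    · intro b _ hb
      rw [if_neg]
      intro h'
      exact hb (Fin.ext (by simp; omega))
  · refine Finset.sum_eq_zero fun b hb => if_neg ?_
    simp only [Finset.mem_filter] at hb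
    omega

theorem apply_eq_partialSum_sub {r : ℕ} (v : E r) (k : Fin (r + 1)) :
    v k = partialSum r (k + 1) v - partialSum r k v := by
  have : (univ.filter fun l : Fin (r + 1) => l.val < k.val + 1)
      = insert k (univ.filter fun l : Fin (r + 1) => l.val < k.val) := by
    ext l
    simp only [mem_filter, mem_univ, true_and, mem_insert, Fin.ext_iff]
    omega
  rw [partialSum_apply, partialSum_apply, this, Finset.sum_insert (by simp)]
  ring

theorem ext_partialSum {r : ℕ} {v w : E r}
    (h : ∀ m ≤ r + 1, partialSum r m v = partialSum r m w) : v = w := by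
  ext k
  rw [apply_eq_partialSum_sub, apply_eq_partialSum_sub, h _ (by omega), h _ (by omega)]

theorem partialSum_zero {r : ℕ} (v : E r) : partialSum r 0 v = 0 := by
  simp [partialSum_apply]

/-! ### Coordinates of `ρ` and of the highest root -/

/-- The partial sums of a root form the indicator of its index interval, from which the interval can
be read off. Needed because `positiveRoots` is an image: the sum defining `rho` may then run over
pairs. -/
theorem root_injOn (r : ℕ) :
    Set.InjOn (fun p : ℕ × ℕ => root r p.1 p.2)
      ((Icc 1 r ×ˢ Icc 1 r).filter (fun p => p.1 ≤ p.2) : Finset (ℕ × ℕ)) := by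
  rintro ⟨i, j⟩ h ⟨i', j'⟩ h' hroot
  simp only [coe_filter, mem_product, mem_Icc, Set.mem_ofPred_eq] at h h'
  have key : ∀ m, (i ≤ m ∧ m ≤ j) ↔ (i' ≤ m ∧ m ≤ j') := by
    intro m
    have := congrArg (partialSum r m) hroot
    simp only at this
    rw [partialSum_root (by omega) (by omega), partialSum_root (by omega) (by omega)] at this
    split_ifs at this <;> first | tauto | norm_num at this
  have h1 := key i
  have h2 := key i'
  have h3 := key j
  have h4 := key j'
  ext <;> simp only <;> omega

/-- Twice this number counts the intervals in 1, …, r that contain m: there are m left ends and r +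
1 - m right ends. -/
theorem partialSum_rho {r m : ℕ} (hm : m ≤ r + 1) :
    partialSum r m (rho r) = m * (r + 1 - m) / 2 := by
  have hcard : (((Icc 1 r ×ˢ Icc 1 r).filter (fun p : ℕ × ℕ => p.1 ≤ p.2)).filter
      (fun p => p.1 ≤ m ∧ m ≤ p.2)) = Icc 1 m ×ˢ Icc m r := by
    ext ⟨a, b⟩
    simp only [mem_filter, mem_product, mem_Icc]
    omega
  have hsum : partialSum r m (∑ β ∈ positiveRoots r, β) = m * (r + 1 - m) := by
    classical
    have : positiveRoots r = ((Icc 1 r ×ˢ Icc 1 r).filter (fun p : ℕ × ℕ => p.1 ≤ p.2)).image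
        (fun p => root r p.1 p.2) := by
      unfold positiveRoots
      congr
    rw [this, Finset.sum_image (root_injOn r), map_sum]
    have : ∀ p ∈ (Icc 1 r ×ˢ Icc 1 r).filter (fun p : ℕ × ℕ => p.1 ≤ p.2),
        partialSum r m (root r p.1 p.2) = if p.1 ≤ m ∧ m ≤ p.2 then 1 else 0 := by
      intro p hp
      simp only [mem_filter, mem_product, mem_Icc] at hp
      exact partialSum_root (by omega) (by omega) m
    rw [Finset.sum_congr rfl this, Finset.sum_boole, hcard, card_product, Nat.card_Icc,
      Nat.card_Icc]
    push_cast [Nat.cast_sub hm]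
    simp
  rw [rho, map_smul, hsum, smul_eq_mul]
  ring

theorem rho_apply {r : ℕ} (k : Fin (r + 1)) : rho r k = r / 2 - k := by
  rw [apply_eq_partialSum_sub, partialSum_rho (by omega), partialSum_rho (by omega)]
  push_cast
  ring

/-- The coordinates of `α̃ + ρ` are `r / 2 - weight r k`. -/
def weight (r k : ℕ) : ℤ := if k = 0 then -1 else if k = r then r + 1 else k

theorem highestRoot_add_rho_apply {r : ℕ} (hr : 1 ≤ r) (k : Fin (r + 1)) :
    (highestRoot r + rho r) k = r / 2 - weight r k := by
  rw [PiLp.add_apply, rho_apply, apply_eq_partialSum_sub, highestRoot,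
    partialSum_root le_rfl le_rfl, partialSum_root le_rfl le_rfl, weight]
  have := k.2
  by_cases h0 : k.val = 0
  · rw [if_pos (by omega), if_neg (by omega), if_pos h0, h0]
    push_cast
    ring
  by_cases hk : k.val = r
  · rw [if_neg (by omega), if_pos (by omega), if_neg h0, if_pos hk, hk]
    push_cast
    ring
  · rw [if_pos (by omega), if_pos (by omega), if_neg h0, if_neg hk]
    push_cast
    ring

/-! ### Positivity of Kostant's partition function -/

/-- The linear form `h` is at least 1 on every positive root, so each coefficient is at most `h ξ`.
Without finiteness, `Nat.card` would take its default value 0. -/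
theorem finite_partitions (r : ℕ) (ξ : E r) :
    Finite {c : positiveRoots r → ℕ // ∑ β : positiveRoots r, c β • (β : E r) = ξ} := by
  let h : E r →ₗ[ℝ] ℝ := ∑ m ∈ Icc 1 r, partialSum r m
  have hroot : ∀ β : positiveRoots r, 1 ≤ h β := by
    rintro ⟨β, hβ⟩
    simp only [positiveRoots, mem_image, mem_filter, mem_product, mem_Icc] at hβ
    obtain ⟨⟨i, j⟩, hij, rfl⟩ := hβ
    simp only [h, LinearMap.sum_apply] at *
    rw [Finset.sum_congr rfl fun m _ => partialSum_root (by omega) (by omega) m]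
    refine le_trans ?_ (Finset.single_le_sum (f := fun m => if i ≤ m ∧ m ≤ j then (1 : ℝ) else 0)
      (fun m _ => by split_ifs <;> norm_num) (mem_Icc.2 (by omega : 1 ≤ i ∧ i ≤ r)))
    simp [hij.2]
  refine Set.Finite.subset (Set.finite_Iic fun _ : positiveRoots r => ⌊h ξ⌋₊) ?_
  intro c hc β
  have hc : ∑ β : positiveRoots r, c β • (β : E r) = ξ := hc
  refine Nat.le_floor ?_
  rw [← hc, map_sum]
  have hterm : ∀ β : positiveRoots r, (c β : ℝ) ≤ h (c β • (β : E r)) := by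
    intro β
    rw [map_nsmul, nsmul_eq_mul]
    exact le_mul_of_one_le_right (Nat.cast_nonneg _) (hroot β)
  exact (hterm β).trans (Finset.single_le_sum (f := fun β : positiveRoots r => h (c β • (β : E r)))
    (fun β _ => (Nat.cast_nonneg _).trans (hterm β)) (mem_univ β))

theorem kostantPartition_pos_iff_mem_closure {r : ℕ} {ξ : E r} :
    0 < kostantPartition r ξ ↔ ξ ∈ AddSubmonoid.closure (positiveRoots r : Set (E r)) := by
  have := finite_partitions r ξ
  rw [kostantPartition, Nat.card_pos_iff, AddSubmonoid.mem_closure_finset',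
    and_iff_left this, nonempty_subtype]
  simp only [eq_comm]

theorem simpleRoot_eq_root {r : ℕ} (k : Fin r) :
    simpleRoot r k = root r (k + 1) (k + 1) := by
  refine ext_partialSum fun m _ => ?_
  rw [partialSum_simpleRoot, partialSum_root (by omega) (by omega)]
  congr 1
  exact propext (by omega)

theorem eq_sum_partialSum_smul_simpleRoot {r : ℕ} {ξ : E r} (h : partialSum r (r + 1) ξ = 0) :
    ξ = ∑ k : Fin r, partialSum r (k + 1) ξ • simpleRoot r k := by
  refine ext_partialSum fun m hm => ?_
  simp only [map_sum, map_smul, partialSum_simpleRoot, smul_eq_mul, mul_ite, mul_one, mul_zero]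
  rcases Nat.eq_zero_or_pos m with rfl | hm0
  · simp [partialSum_zero]
  rcases hm.eq_or_lt with rfl | hm1
  · rw [h, Finset.sum_eq_zero]
    exact fun k _ => if_neg (by omega)
  · rw [Finset.sum_eq_single (⟨m - 1, by omega⟩ : Fin r)]
    · simp [Nat.sub_add_cancel hm0]
    · intro b _ hb
      rw [if_neg]
      intro h'
      exact hb (Fin.ext (by simp; omega))
    · simp

theorem kostantPartition_pos_iff {r : ℕ} {ξ : E r} {P : ℕ → ℤ}
    (hP : ∀ m, partialSum r m ξ = P m) (h0 : partialSum r (r + 1) ξ = 0) :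
    0 < kostantPartition r ξ ↔ ∀ m, m ≤ r + 1 → 0 ≤ P m := by
  rw [kostantPartition_pos_iff_mem_closure]
  constructor
  · intro h m _
    rw [← @Int.cast_nonneg_iff ℝ, ← hP]
    clear hP h0
    induction h using AddSubmonoid.closure_induction with
    | mem β hβ =>
      simp only [positiveRoots, coe_image, coe_filter, mem_product, mem_Icc, Set.mem_image,
        Set.mem_ofPred_eq] at hβ
      obtain ⟨⟨i, j⟩, hij, rfl⟩ := hβ
      simp only at hij ⊢
      rw [partialSum_root (by omega) (by omega)]
      split_ifs <;> norm_num
    | zero => simp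
    | add x y _ _ hx hy =>
      rw [map_add]
      exact add_nonneg hx hy
  · intro h
    rw [eq_sum_partialSum_smul_simpleRoot h0]
    refine sum_mem fun k _ => ?_
    obtain ⟨n, hn⟩ := Int.eq_ofNat_of_zero_le (h (k + 1) (by omega))
    rw [hP, hn, Int.cast_natCast, Nat.cast_smul_eq_nsmul]
    refine AddSubmonoid.nsmul_mem _ (AddSubmonoid.subset_closure ?_) _
    simp only [positiveRoots, coe_image, coe_filter, mem_product, mem_Icc, Set.mem_image,
        Set.mem_ofPred_eq]
    exact ⟨(k + 1, k + 1), by simp, (simpleRoot_eq_root k).symm⟩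

/-! ### The Weyl group as a symmetric group -/

/-- The action of a permutation on coordinates. -/
noncomputable def permHom (r : ℕ) : Equiv.Perm (Fin (r + 1)) →* (E r ≃ₗᵢ[ℝ] E r) where
  toFun π := LinearIsometryEquiv.piLpCongrLeft 2 ℝ ℝ π
  map_one' := by ext; rfl
  map_mul' _ _ := by ext; rfl

theorem permHom_apply {r : ℕ} (π : Equiv.Perm (Fin (r + 1))) (v : E r) (k : Fin (r + 1)) :
    permHom r π v k = v (π⁻¹ k) := rfl

theorem permHom_single {r : ℕ} (π : Equiv.Perm (Fin (r + 1))) (k : Fin (r + 1)) :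
    permHom r π (EuclideanSpace.single k 1) = EuclideanSpace.single (π k) 1 :=
  LinearIsometryEquiv.piLpCongrLeft_single π k 1

theorem permHom_injective (r : ℕ) : Function.Injective (permHom r) := by
  intro π π' h
  ext k
  have h1 := congrArg (fun f : E r ≃ₗᵢ[ℝ] E r => f (EuclideanSpace.single k 1) (π k)) h
  simp only [permHom_single, PiLp.single_apply] at h1
  by_contra hne
  rw [if_neg (fun h' => hne (congrArg Fin.val h'))] at h1
  simp at h1

theorem permHom_swap {r : ℕ} (k : Fin r) :
    permHom r (Equiv.swap k.castSucc k.succ) = simpleReflection r k := by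
  ext v l
  rw [permHom_apply, simpleReflection, Submodule.reflection_orthogonal_apply,
    Submodule.reflection_singleton_apply, Equiv.swap_inv]
  have hne : k.castSucc ≠ k.succ := by simp [Fin.ext_iff]
  have hinner : ∀ v, inner ℝ (simpleRoot r k) v = v k.castSucc - v k.succ := fun v => by
    simp [simpleRoot, inner_sub_left, EuclideanSpace.inner_single_left]
  have hnorm : ‖simpleRoot r k‖ ^ 2 = 2 := by
    rw [← real_inner_self_eq_norm_sq, hinner]
    simp [simpleRoot, hne, hne.symm]
    norm_num
  simp only [RCLike.ofReal_real_eq_id, id, hnorm, hinner]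
  simp only [simpleRoot, PiLp.neg_apply, PiLp.sub_apply, PiLp.smul_apply, smul_eq_mul,
    PiLp.single_apply, nsmul_eq_mul]
  rcases eq_or_ne l k.castSucc with rfl | h1
  · simp [hne]
    ring
  rcases eq_or_ne l k.succ with rfl | h2
  · simp [hne.symm]
    ring
  · simp [Equiv.swap_apply_of_ne_of_ne h1 h2, h1, h2]

/-- Adjacent transpositions generate the symmetric group and act as the simple reflections. -/
theorem permHom_range (r : ℕ) : (permHom r).range = weylGroup r := by
  have htop : Subgroup.closure
      (Set.range fun k : Fin r => Equiv.swap k.castSucc k.succ) = ⊤ :=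
    Subgroup.closure_eq_top_of_mclosure_eq_top (Equiv.Perm.mclosure_swap_castSucc_succ r)
  rw [MonoidHom.range_eq_map, ← htop, MonoidHom.map_closure, weylGroup, ← Set.range_comp]
  congr 2
  ext1 k
  exact permHom_swap k

/-- The permutations that satisfy the inequalities cutting out the alternation set. -/
def admissiblePerms (r i j : ℕ) : Finset (Equiv.Perm (Fin (r + 1))) :=
  univ.filter fun π => ∀ m ≤ r + 1,
    ∑ k : Fin (r + 1) with k.val < m, (weight r (π k) - k : ℤ) ≤ if i ≤ m ∧ m ≤ j then 1 else 0

/-- The constants r / 2 in both coordinate vectors cancel, leaving only weights and positions. The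
inverse appears because `permHom r π` reads coordinate k at `π⁻¹ k`. -/
theorem permHom_mem_iff {r i j : ℕ} (hi : 1 ≤ i) (hij : i ≤ j) (hj : j ≤ r)
    (π : Equiv.Perm (Fin (r + 1))) :
    0 < kostantPartition r (permHom r π (highestRoot r + rho r) - (-root r i j) - rho r) ↔
      π⁻¹ ∈ admissiblePerms r i j := by
  rw [kostantPartition_pos_iff (P := fun m => (if i ≤ m ∧ m ≤ j then 1 else 0) -
    ∑ k : Fin (r + 1) with k.val < m, (weight r (π⁻¹ k) - k : ℤ))]
  · simp [admissiblePerms]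
  · intro m
    rw [map_sub, map_sub, map_neg, partialSum_root hi hj, partialSum_apply, partialSum_apply]
    simp only [permHom_apply, highestRoot_add_rho_apply (hi.trans (hij.trans hj)), rho_apply]
    push_cast
    simp only [Finset.sum_sub_distrib]
    ring
  · have hperm : partialSum r (r + 1) (permHom r π (highestRoot r + rho r)) =
        partialSum r (r + 1) (highestRoot r + rho r) := by
      simp only [partialSum_apply, Fin.is_lt, filter_true, permHom_apply]
      exact Equiv.sum_comp π⁻¹ fun k => (highestRoot r + rho r) k
    rw [map_sub, map_sub, map_neg, hperm, map_add, highestRoot, partialSum_root le_rfl le_rfl,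
      partialSum_root hi hj, if_neg (by omega), if_neg (by omega)]
    ring

theorem ncard_alternationSet {r i j : ℕ} (hi : 1 ≤ i) (hij : i ≤ j) (hj : j ≤ r) :
    (alternationSet r (highestRoot r) (-root r i j)).ncard = #(admissiblePerms r i j) := by
  have hmem : ∀ π, permHom r π ∈ weylGroup r := fun π => by
    rw [← permHom_range]
    exact ⟨π, rfl⟩
  rw [← Set.ncard_coe_finset]
  symm
  refine Set.ncard_congr (fun π _ => ⟨permHom r π⁻¹, hmem _⟩) ?_ ?_ ?_
  · intro π h
    exact (permHom_mem_iff hi hij hj _).2 (by simpa using h)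
  · intro π π' _ _ h
    exact inv_injective (permHom_injective r (congrArg Subtype.val h))
  · rintro ⟨σ, hσ⟩ h
    obtain ⟨π, rfl⟩ : σ ∈ (permHom r).range := by rwa [permHom_range]
    exact ⟨π⁻¹, (permHom_mem_iff hi hij hj π).1 h, by simp⟩

/-! ### Counting admissible permutations value by value -/

/-- The number of ways to append `k` further values to a word of length `m` whose set of values is
`S` and whose accumulated excess is `acc`, keeping all excesses admissible. -/
def extensionCount (r i j : ℕ) : ℕ → ℕ → Finset ℕ → ℤ → ℕ
  | 0, _, _, _ => 1
  | k + 1, m, S, acc =>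
    ∑ x ∈ range (r + 1) \ S with
        acc + (weight r x - m) ≤ (if i ≤ m + 1 ∧ m + 1 ≤ j then 1 else 0),
      extensionCount r i j k (m + 1) (insert x S) (acc + (weight r x - m))

/-- The words counted by `extensionCount`. -/
def IsExtension (r i j k m : ℕ) (S : Finset ℕ) (acc : ℤ) (f : Fin k → Fin (r + 1)) : Prop :=
  Function.Injective f ∧ (∀ a, (f a : ℕ) ∉ S) ∧
    ∀ n < k, acc + ∑ a : Fin k, (if a.val ≤ n then (weight r (f a) - (m + a : ℕ) : ℤ) else 0) ≤
      if i ≤ m + n + 1 ∧ m + n + 1 ≤ j then 1 else 0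

theorem isExtension_cons {r i j k m : ℕ} {S : Finset ℕ} {acc : ℤ} (x : Fin (r + 1))
    (f : Fin k → Fin (r + 1)) :
    IsExtension r i j (k + 1) m S acc (Fin.cons x f : Fin (k + 1) → Fin (r + 1)) ↔
      (x.val ∉ S ∧ acc + (weight r x - m) ≤ (if i ≤ m + 1 ∧ m + 1 ≤ j then 1 else 0)) ∧
        IsExtension r i j k (m + 1) (insert x.val S) (acc + (weight r x - m)) f := by
  have hsum : ∀ n, acc + ∑ a : Fin (k + 1), (if a.val ≤ n then
      (weight r ((Fin.cons x f : Fin (k + 1) → Fin (r + 1)) a) - (m + a : ℕ) : ℤ) else 0) =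
      acc + (weight r x - m) + ∑ a : Fin k, (if a.val + 1 ≤ n then
        (weight r (f a) - (m + 1 + a : ℕ) : ℤ) else 0) := by
    intro n
    rw [Fin.sum_univ_succ, add_assoc]
    simp only [Fin.val_zero, Nat.zero_le, if_true, Fin.cons_zero, Fin.cons_succ, Fin.val_succ,
      add_zero]
    congr 3
    ext a
    rw [add_right_comm m 1, add_assoc]
  unfold IsExtension
  simp only [hsum, Fin.cons_injective_iff, Fin.forall_fin_succ, Fin.cons_zero, Fin.cons_succ,
    mem_insert, not_or, Set.mem_range, not_exists]
  constructor
  · rintro ⟨⟨h1, h2⟩, ⟨h3, h4⟩, h5⟩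
    refine ⟨⟨h3, by simpa using h5 0 (by omega)⟩, h2, fun a => ⟨fun h => h1 a (Fin.ext h), h4 a⟩,
      fun n hn => ?_⟩
    have := h5 (n + 1) (by omega)
    simpa [add_assoc, add_comm 1] using this
  · rintro ⟨⟨h1, h2⟩, h3, h4, h5⟩
    refine ⟨⟨fun a h => (h4 a).1 (congrArg Fin.val h), h3⟩, ⟨h1, fun a => (h4 a).2⟩,
      fun n hn => ?_⟩
    cases n with
    | zero => simpa using h2
    | succ n =>
      have := h5 n (by omega)
      simpa [add_assoc, add_comm 1] using this

open Classical in
theorem card_isExtension (r i j k : ℕ) : ∀ (m : ℕ) (S : Finset ℕ) (acc : ℤ),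
    #{f : Fin k → Fin (r + 1) | IsExtension r i j k m S acc f} =
      extensionCount r i j k m S acc := by
  induction k with
  | zero =>
    intro m S acc
    simp [extensionCount, IsExtension, Function.injective_of_subsingleton]
  | succ k ih =>
    intro m S acc
    rw [Finset.card_filter, ← (Fin.consEquiv fun _ => Fin (r + 1)).sum_comp, Fintype.sum_prod_type,
      extensionCount, Finset.sum_filter, ← Finset.filter_notMem_eq_sdiff, Finset.sum_filter,
      Finset.sum_range]
    refine Finset.sum_congr rfl fun x _ => ?_
    have : ∀ f : Fin k → Fin (r + 1), (Fin.consEquiv fun _ => Fin (r + 1)) (x, f) =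
      (Fin.cons x f : Fin (k + 1) → Fin (r + 1)) := fun _ => rfl
    simp only [this, isExtension_cons]
    rw [← ih, Finset.card_filter]
    by_cases h1 : x.val ∈ S
    · simp [h1]
    · split_ifs <;> simp_all

theorem card_admissiblePerms (r i j : ℕ) :
    #(admissiblePerms r i j) = extensionCount r i j (r + 1) 0 ∅ 0 := by
  classical
  rw [← card_isExtension]
  refine Finset.card_bij (fun π _ => ⇑π) ?_ ?_ ?_
  · intro π h
    simp only [admissiblePerms, mem_filter, mem_univ, true_and] at h
    simp only [mem_filter, mem_univ, true_and]
    refine ⟨π.injective, by simp, fun n hn => ?_⟩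
    have := h (n + 1) (by omega)
    simp only [Finset.sum_filter, Nat.lt_succ_iff] at this
    simpa only [zero_add, Nat.cast_zero] using this
  · intro π _ π' _ h
    exact DFunLike.coe_injective h
  · intro f hf
    simp only [mem_filter, mem_univ, true_and] at hf
    refine ⟨Equiv.ofBijective f (Finite.injective_iff_bijective.1 hf.1), ?_, rfl⟩
    simp only [admissiblePerms, mem_filter, mem_univ, true_and]
    intro m hm
    cases m with
    -- `extensionCount` tests only nonempty prefixes; the empty one has excess 0.
    | zero => simp; split_ifs <;> simp
    | succ n =>
      have := hf.2.2 n (by omega)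
      simp only [Finset.sum_filter, Nat.lt_succ_iff, Equiv.ofBijective_apply]
      simpa only [zero_add, Nat.cast_zero] using this

/-! ### The four kinds of reachable value sets -/

/-- Extensions of a word of length `m` with values `0, …, m - 1`. -/
def countInitial (r i j m : ℕ) : ℕ :=
  extensionCount r i j (r + 1 - m) m (range m) (if m = 0 then 0 else if m ≤ r then -1 else 0)

/-- Extensions of a word of length `n + 1` with values `0, …, n - 1, n + 1`. -/
def countSkipOne (r i j n : ℕ) : ℕ :=
  extensionCount r i j (r - n) (n + 1) (insert (n + 1) (range n))
    (if 1 ≤ n ∧ n + 1 < r then 0 else 1)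

/-- Extensions of a word of length `n + 1` with values `0, …, n - 1, n + 2`. -/
def countSkipTwo (r i j n : ℕ) : ℕ :=
  extensionCount r i j (r - n) (n + 1) (insert (n + 2) (range n)) 1

/-- Extensions of a word of length `n + 2` with values `0, …, n - 1, n + 1, n + 2`. -/
def countSkipOnePair (r i j n : ℕ) : ℕ :=
  extensionCount r i j (r - (n + 1)) (n + 2) (insert (n + 2) (insert (n + 1) (range n))) 1

theorem mem_ite_singleton_empty {c : Prop} [Decidable c] {x a : ℕ} :
    x ∈ (if c then {a} else ∅ : Finset ℕ) ↔ c ∧ x = a := by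
  split_ifs with h <;> simp [h]

theorem sum_ite_singleton_empty {c : Prop} [Decidable c] {a b : ℕ} {F : ℕ → ℕ}
    (h : c → F a = b) :
    ∑ x ∈ (if c then {a} else ∅ : Finset ℕ), F x = if c then b else 0 := by
  split_ifs with hc
  · rw [sum_singleton, h hc]
  · rfl

theorem extensionCount_congr {r i j k k' m m' : ℕ} {S S' : Finset ℕ} {acc acc' : ℤ} (hk : k = k')
    (hm : m = m') (hS : S = S') (hacc : acc = acc') :
    extensionCount r i j k m S acc = extensionCount r i j k' m' S' acc' := by
  rw [hk, hm, hS, hacc]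

section Transitions

variable {r i j : ℕ}

/-- For 0 < m ≤ r the excess is -1, inherited from `weight r 0 = -1`, so m always fits, m + 1 brings
the excess to 0 and m + 2 brings it to 1, which only the window allows. The value r costs one more,
hence the margins near the end; at m = 0 the saving is not yet made. The case r = 1 is excluded for
`countSkipOne` because the value 1 is then both first skip and last value, of excess 2. -/
theorem countInitial_step (hi : 1 ≤ i) (hij : i ≤ j) (hj : j ≤ r) {m : ℕ} (hm : m ≤ r) :
    countInitial r i j m = countInitial r i j (m + 1) +
      ((if (2 ≤ m + 1 ∧ m + 2 ≤ r) ∨ (i ≤ m + 1 ∧ m + 1 ≤ j ∧ 2 ≤ r) then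
        countSkipOne r i j m else 0) +
      (if 1 ≤ m ∧ m + 3 ≤ r ∧ i ≤ m + 1 ∧ m + 1 ≤ j then countSkipTwo r i j m else 0)) := by
  have hf : (range (r + 1) \ range m).filter (fun x =>
      (if m = 0 then 0 else if m ≤ r then -1 else 0 : ℤ) + (weight r x - m) ≤
        (if i ≤ m + 1 ∧ m + 1 ≤ j then 1 else 0)) =
      insert m ((if (2 ≤ m + 1 ∧ m + 2 ≤ r) ∨ (i ≤ m + 1 ∧ m + 1 ≤ j ∧ 2 ≤ r) then
        {m + 1} else ∅) ∪
        (if 1 ≤ m ∧ m + 3 ≤ r ∧ i ≤ m + 1 ∧ m + 1 ≤ j then {m + 2} else ∅)) := by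
    ext x
    simp only [mem_filter, mem_sdiff, mem_range, mem_insert, mem_union]
    simp only [mem_ite_singleton_empty, weight]
    split_ifs <;> first | contradiction | omega
  have e0 : extensionCount r i j (r - m) (m + 1) (insert m (range m))
      ((if m = 0 then 0 else if m ≤ r then -1 else 0) + (weight r m - m)) =
      countInitial r i j (m + 1) := by
    refine extensionCount_congr (by omega) rfl range_add_one.symm ?_
    rw [weight]
    split_ifs <;> first | contradiction | omega
  have e1 (h : (2 ≤ m + 1 ∧ m + 2 ≤ r) ∨ (i ≤ m + 1 ∧ m + 1 ≤ j ∧ 2 ≤ r)) :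
      extensionCount r i j (r - m) (m + 1) (insert (m + 1) (range m))
        ((if m = 0 then 0 else if m ≤ r then -1 else 0) + (weight r (m + 1) - m)) =
      countSkipOne r i j m := by
    refine extensionCount_congr rfl rfl rfl ?_
    rw [weight]
    split_ifs <;> first | contradiction | omega
  have e2 (h : 1 ≤ m ∧ m + 3 ≤ r ∧ i ≤ m + 1 ∧ m + 1 ≤ j) :
      extensionCount r i j (r - m) (m + 1) (insert (m + 2) (range m))
        ((if m = 0 then 0 else if m ≤ r then -1 else 0) + (weight r (m + 2) - m)) =
      countSkipTwo r i j m := by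
    refine extensionCount_congr rfl rfl rfl ?_
    rw [weight]
    split_ifs <;> first | contradiction | omega
  conv_lhs => rw [countInitial, show r + 1 - m = r - m + 1 by omega, extensionCount, hf]
  rw [Finset.sum_insert (by simp [mem_ite_singleton_empty]),
    Finset.sum_union (by split_ifs <;> simp), e0, sum_ite_singleton_empty e1,
    sum_ite_singleton_empty e2]

theorem countSkipOne_step (hj : j ≤ r) {n : ℕ} (hn : n + 1 ≤ r)
    (hr : 2 ≤ r) :
    countSkipOne r i j n = countInitial r i j (n + 2) +
      (if 1 ≤ n ∧ n + 3 ≤ r ∧ i ≤ n + 2 ∧ n + 2 ≤ j then countSkipOnePair r i j n else 0) := by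
  have hf : (range (r + 1) \ insert (n + 1) (range n)).filter (fun x =>
      (if 1 ≤ n ∧ n + 1 < r then 0 else 1 : ℤ) + (weight r x - (n + 1 : ℕ)) ≤
        (if i ≤ n + 1 + 1 ∧ n + 1 + 1 ≤ j then 1 else 0)) =
      insert n (if 1 ≤ n ∧ n + 3 ≤ r ∧ i ≤ n + 2 ∧ n + 2 ≤ j then {n + 2} else ∅) := by
    ext x
    simp only [mem_filter, mem_sdiff, mem_range, mem_insert]
    simp only [mem_ite_singleton_empty, weight]
    split_ifs <;> first | contradiction | omega
  have e0 : extensionCount r i j (r - (n + 1)) (n + 2) (insert n (insert (n + 1) (range n)))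
      ((if 1 ≤ n ∧ n + 1 < r then 0 else 1) + (weight r n - (n + 1 : ℕ))) =
      countInitial r i j (n + 2) := by
    refine extensionCount_congr (by omega) rfl ?_ ?_
    · rw [insert_comm, ← range_add_one, ← range_add_one]
    · rw [weight]
      split_ifs <;> first | contradiction | omega
  have e1 (h : 1 ≤ n ∧ n + 3 ≤ r ∧ i ≤ n + 2 ∧ n + 2 ≤ j) :
      extensionCount r i j (r - (n + 1)) (n + 2) (insert (n + 2) (insert (n + 1) (range n)))
        ((if 1 ≤ n ∧ n + 1 < r then 0 else 1) + (weight r (n + 2) - (n + 1 : ℕ))) =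
      countSkipOnePair r i j n := by
    refine extensionCount_congr rfl rfl rfl ?_
    rw [weight]
    split_ifs <;> first | contradiction | omega
  conv_lhs => rw [countSkipOne, show r - n = r - (n + 1) + 1 by omega, extensionCount, hf]
  rw [Finset.sum_insert (by simp [mem_ite_singleton_empty]), e0, sum_ite_singleton_empty e1]

/-- The excess is already 1, so only the missing values n and n + 1 can follow; n + 1 keeps the
excess at 1 and needs the window. -/
theorem countSkipTwo_step {n : ℕ} (hn : 1 ≤ n) (hn' : n + 3 ≤ r) :
    countSkipTwo r i j n =
      countSkipOne r i j (n + 1) +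
      (if i ≤ n + 2 ∧ n + 2 ≤ j then countSkipOnePair r i j n else 0) := by
  have hf : (range (r + 1) \ insert (n + 2) (range n)).filter (fun x =>
      (1 : ℤ) + (weight r x - (n + 1 : ℕ)) ≤
        (if i ≤ n + 1 + 1 ∧ n + 1 + 1 ≤ j then 1 else 0)) =
      insert n (if i ≤ n + 2 ∧ n + 2 ≤ j then {n + 1} else ∅) := by
    ext x
    simp only [mem_filter, mem_sdiff, mem_range, mem_insert]
    simp only [mem_ite_singleton_empty, weight]
    split_ifs <;> first | contradiction | omega
  have e0 : extensionCount r i j (r - (n + 1)) (n + 2) (insert n (insert (n + 2) (range n)))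
      (1 + (weight r n - (n + 1 : ℕ))) = countSkipOne r i j (n + 1) := by
    refine extensionCount_congr (by omega) rfl ?_ ?_
    · rw [insert_comm, ← range_add_one]
    · rw [weight]
      split_ifs <;> first | contradiction | omega
  have e1 :
      extensionCount r i j (r - (n + 1)) (n + 2) (insert (n + 1) (insert (n + 2) (range n)))
        (1 + (weight r (n + 1) - (n + 1 : ℕ))) = countSkipOnePair r i j n := by
    refine extensionCount_congr rfl rfl (insert_comm _ _ _) ?_
    rw [weight]
    split_ifs <;> first | contradiction | omega
  conv_lhs => rw [countSkipTwo, show r - n = r - (n + 1) + 1 by omega, extensionCount, hf]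
  rw [Finset.sum_insert (by simp [mem_ite_singleton_empty]), e0,
    sum_ite_singleton_empty fun _ => e1]

/-- With excess 1 any larger value overshoots, so the gap n must be filled at once. This closes the
list of four shapes. -/
theorem countSkipOnePair_step {n : ℕ} (hn : 1 ≤ n) (hn' : n + 3 ≤ r) :
    countSkipOnePair r i j n = countInitial r i j (n + 3) := by
  have hf : (range (r + 1) \ insert (n + 2) (insert (n + 1) (range n))).filter (fun x =>
      (1 : ℤ) + (weight r x - (n + 2 : ℕ)) ≤
        (if i ≤ n + 2 + 1 ∧ n + 2 + 1 ≤ j then 1 else 0)) = {n} := by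
    ext x
    simp only [mem_filter, mem_sdiff, mem_range, mem_insert, mem_singleton]
    simp only [weight]
    split_ifs <;> first | contradiction | omega
  conv_lhs => rw [countSkipOnePair, show r - (n + 1) = r - (n + 2) + 1 by omega, extensionCount, hf]
  rw [sum_singleton]
  refine extensionCount_congr (by omega) rfl ?_ ?_
  · rw [insert_comm, insert_comm n, ← range_add_one, ← range_add_one, ← range_add_one]
  · rw [weight]
    split_ifs <;> first | contradiction | omega

end Transitions

/-! ### Solving the recursion -/

/-- The numbers of extensions of words of length `j - p`, for the four kinds of value sets, with
`q = r - j`. -/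
def middleCounts (q : ℕ) : ℕ → ℤ × ℤ × ℤ × ℤ
  | 0 => (Nat.fib (q + 1), Nat.fib q, Nat.fib (q + 1) - Nat.fib q, Nat.fib q)
  | p + 1 =>
    ((middleCounts q p).1 + (middleCounts q p).2.1 + (middleCounts q p).2.2.1,
      (middleCounts q p).1 + (middleCounts q p).2.2.2,
      (middleCounts q p).2.1 + (middleCounts q p).2.2.2,
      (middleCounts q p).1)

/-- The cardinality of the alternation set for `i = k + 1`, `j = k + 1 + p`, `r = k + 1 + p + q`. -/
def alternationCount (k p q : ℕ) : ℤ :=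
  Nat.fib k * (middleCounts q (p + 1)).1 +
    (Nat.fib (k + 1) - Nat.fib k) * (middleCounts q (p + 1)).2.1

section Solution

variable {r i j : ℕ}

theorem countInitial_succ_self : countInitial r i j (r + 1) = 1 := by
  simp [countInitial, extensionCount]

/-- Past the window the word continues by fixed values and swaps of neighbours, and r stays last:
these are tilings of a strip of length t by squares and dominoes. -/
theorem countInitial_of_le (hi : 1 ≤ i) (hij : i ≤ j) (hj : j ≤ r) {t m : ℕ} (hm : m + t = r)
    (hjm : j ≤ m) : countInitial r i j m = Nat.fib (t + 1) := by
  induction t using Nat.twoStepInduction generalizing m with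
  | zero =>
    rw [countInitial_step hi hij hj (by omega), if_neg (by omega), if_neg (by omega),
      show m = r by omega, countInitial_succ_self]
    rfl
  | one =>
    rw [countInitial_step hi hij hj (by omega), if_neg (by omega), if_neg (by omega),
      countInitial_step hi hij hj (by omega), if_neg (by omega), if_neg (by omega),
      show m + 1 = r by omega, countInitial_succ_self]
    rfl
  | more t ih1 ih2 =>
    rw [countInitial_step hi hij hj (by omega), if_pos (by omega), if_neg (by omega),
      countSkipOne_step hj (by omega) (by omega), if_neg (by omega), ih1 (m := m + 2) (by omega) (by omega),
      ih2 (m := m + 1) (by omega) (by omega), Nat.fib_add_two (n := t + 1)]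
    ring

/-- Backward induction from the end of the window. The fourth component is `countInitial` at m + 1
because a pair state of length m has that single continuation. For j = r and p = 0 the vector (1, 0,
1, 0) is only a formal continuation of the Fibonacci pattern, which is why `hp` excludes it. -/
theorem counts_eq_middleCounts (hi : 1 ≤ i) (hij : i ≤ j) (hj : j ≤ r) {p m : ℕ}
    (hm : m + p = j) (hm1 : 1 ≤ m) (him : i ≤ m + 1) (hp : 1 ≤ p ∨ j < r) :
    (countInitial r i j m : ℤ) = (middleCounts (r - j) p).1 ∧
    (countInitial r i j (m + 1) : ℤ) = (middleCounts (r - j) p).2.2.2 ∧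
    ∀ n, m = n + 1 → 1 ≤ n →
      (countSkipOne r i j n : ℤ) = (middleCounts (r - j) p).2.1 ∧
      (i ≤ m → ((if m + 2 ≤ r then countSkipTwo r i j n else 0 : ℕ) : ℤ) =
        (middleCounts (r - j) p).2.2.1) := by
  induction p generalizing m with
  | zero =>
    obtain ⟨q, rfl⟩ : ∃ q, r = j + (q + 1) := ⟨r - j - 1, by omega⟩
    obtain rfl : m = j := hm
    simp only [Nat.add_sub_cancel_left, middleCounts]
    have h0 := countInitial_of_le hi hij hj (t := q + 1) rfl le_rfl
    have h1 : countInitial (m + (q + 1)) i m (m + 1) = Nat.fib (q + 1) :=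
      countInitial_of_le hi hij hj (by omega) (by omega)
    refine ⟨by rw [h0], by rw [h1], ?_⟩
    rintro n rfl hn
    refine ⟨?_, fun _ => ?_⟩
    · rw [countSkipOne_step hj (by omega) (by omega), if_neg (by omega), h1, add_zero]
    · cases q with
      | zero => simp
      | succ q =>
        rw [if_pos (by omega), countSkipTwo_step hn (by omega), if_neg (by omega),
          countSkipOne_step hj (by omega) (by omega), if_neg (by omega),
          countInitial_of_le hi hij hj (t := q) (by omega) (by omega), Nat.fib_add_two (n := q + 1)]
        push_cast
        ring
  | succ p ih =>
    by_cases hp' : 1 ≤ p ∨ j < r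
    · obtain ⟨h0, h3, h⟩ := ih (m := m + 1) (by omega) (by omega) (by omega) hp'
      obtain ⟨h1, h2⟩ := h m rfl hm1
      specialize h2 him
      simp only [middleCounts]
      refine ⟨?_, h0, ?_⟩
      · rw [countInitial_step hi hij hj (by omega), if_pos (by omega), ← h0, ← h1, ← h2]
        have : (1 ≤ m ∧ m + 3 ≤ r ∧ i ≤ m + 1 ∧ m + 1 ≤ j) ↔ m + 1 + 2 ≤ r := by omega
        simp only [this]
        push_cast
        ring
      · rintro n rfl hn
        refine ⟨?_, fun hin => ?_⟩
        · rw [countSkipOne_step hj (by omega) (by omega), if_pos (by omega),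
            countSkipOnePair_step hn (by omega), ← h0, ← h3]
          push_cast
          rfl
        · rw [if_pos (by omega), countSkipTwo_step hn (by omega), if_pos (by omega),
            countSkipOnePair_step hn (by omega), ← h1, ← h3]
          push_cast
          rfl
    -- Here j = r, and one transfer step applied to the formal vector (1, 0, 1, 0) gives (2, 1, 0,
    -- 1), the true counts one place before the end of the window.
    · obtain rfl : p = 0 := by omega
      obtain rfl : j = r := by omega
      obtain rfl : m + 1 = j := hm
      have hlast := countInitial_succ_self (r := m + 1) (i := i) (j := m + 1)
      have h0 : countInitial (m + 1) i (m + 1) (m + 1) = 1 :=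
        countInitial_of_le hi hij hj (t := 0) rfl le_rfl
      simp only [middleCounts, Nat.sub_self, Nat.fib_zero, Nat.fib_one, zero_add]
      refine ⟨?_, by rw [h0], ?_⟩
      · rw [countInitial_step hi hij hj (by omega), if_pos (by omega), if_neg (by omega),
          countSkipOne_step hj (by omega) (by omega), if_neg (by omega), h0, hlast]
        norm_num
      · rintro n rfl hn
        refine ⟨?_, fun _ => ?_⟩
        · rw [countSkipOne_step hj (by omega) (by omega), if_neg (by omega), h0]
          norm_num
        · rw [if_neg (by omega)]
          norm_num

/-- Before the window only swaps of neighbours occur; the coefficients count the prefixes that reach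
each of the two possible states. -/
theorem countInitial_one (hi : 1 ≤ i) (hij : i ≤ j) (hj : j ≤ r) {n : ℕ} (hn : n + 2 ≤ i) :
    countInitial r i j 1 =
      Nat.fib (n + 1) * countInitial r i j (n + 1) + Nat.fib n * countSkipOne r i j n := by
  induction n with
  | zero => simp
  | succ n ih =>
    rw [ih (by omega), countInitial_step hi hij hj (m := n + 1) (by omega), if_pos (by omega),
      if_neg (by omega), countSkipOne_step hj (n := n) (by omega) (by omega), if_neg (by omega),
      Nat.fib_add_two]
    ring

theorem card_admissiblePerms_eq_alternationCount (hi : 1 ≤ i) (hij : i ≤ j) (hj : j ≤ r) :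
    (#(admissiblePerms r i j) : ℤ) = alternationCount (i - 1) (j - i) (r - j) := by
  have h0 : #(admissiblePerms r i j) = countInitial r i j 0 := by
    rw [card_admissiblePerms, countInitial, range_zero, if_pos rfl, Nat.sub_zero]
  rw [h0, countInitial_step hi hij hj (Nat.zero_le r), alternationCount]
  -- For i = 1 the coefficients are 0 and 1 (the Fibonacci number of index -1). The selected second
  -- component unfolds to `countInitial` at 1 plus `countInitial` at 2, which is what the first
  -- letter 0 or 1 leads to when r ≥ 2.
  rcases hi.eq_or_lt with rfl | hi2
  · simp only [Nat.sub_self, Nat.fib_zero, zero_add, Nat.fib_one, Nat.cast_zero, Nat.cast_one,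
      zero_mul, sub_zero, one_mul]
    by_cases hr : 2 ≤ r
    · obtain ⟨h1, h2, -⟩ := counts_eq_middleCounts (m := 1) (p := j - 1) hi hij hj (by omega) le_rfl
        (by omega) (by omega)
      rw [if_pos (by omega), if_neg (by omega), countSkipOne_step hj (by omega) hr,
        if_neg (by omega), middleCounts, ← h1, ← h2]
      push_cast
      rfl
    · obtain rfl : j = 1 := by omega
      obtain rfl : r = 1 := by omega
      rw [if_neg (by omega), if_neg (by omega),
        countInitial_of_le hi hij hj (t := 0) rfl le_rfl]
      rfl
  · obtain ⟨n, rfl⟩ : ∃ n, i = n + 2 := ⟨i - 2, by omega⟩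
    obtain ⟨h1, -, h3⟩ := counts_eq_middleCounts (m := n + 1) (p := j - (n + 2) + 1) hi hij hj
      (by omega) (by omega) (by omega) (by omega)
    rw [if_neg (by omega), if_neg (by omega), zero_add, add_zero, add_zero,
      countInitial_one hi hij hj le_rfl, show n + 2 - 1 = n + 1 by omega, Nat.fib_add_two, ← h1]
    push_cast
    -- At n = 0 the skip-one state, not covered by `h3`, has coefficient zero.
    rcases Nat.eq_zero_or_pos n with rfl | hn
    · simp
    · rw [← (h3 n rfl hn).1]
      ring

end Solution

open MvPowerSeries

/-! ### Recurrences -/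

theorem alternationCount_rec_left (k p q : ℕ) :
    alternationCount (k + 2) p q = alternationCount (k + 1) p q + alternationCount k p q := by
  simp only [alternationCount, Nat.fib_add_two (n := k), Nat.fib_add_two (n := k + 1)]
  push_cast
  ring

/-- The starting vector is Fibonacci in q, also at q = 0 thanks to its third entry being a
difference, and the transfer step is linear. -/
theorem middleCounts_rec (q p : ℕ) :
    middleCounts (q + 2) p = middleCounts (q + 1) p + middleCounts q p := by
  induction p with
  | zero =>
    simp only [middleCounts, Prod.mk_add_mk, Nat.fib_add_two (n := q),
      Nat.fib_add_two (n := q + 1)]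
    push_cast
    ext <;> simp only <;> ring
  | succ p ih =>
    simp only [middleCounts, ih, Prod.mk_add_mk, Prod.fst_add, Prod.snd_add]
    ext <;> simp only <;> ring

theorem alternationCount_rec_right (k p q : ℕ) :
    alternationCount k p (q + 2) = alternationCount k p (q + 1) + alternationCount k p q := by
  simp only [alternationCount, middleCounts_rec, Prod.fst_add, Prod.snd_add]
  ring

/-- Cayley–Hamilton for the transfer matrix. -/
theorem alternationCount_rec_middle (k p q : ℕ) :
    alternationCount k (p + 4) q = alternationCount k (p + 3) q + alternationCount k (p + 2) q +
      3 * alternationCount k (p + 1) q + alternationCount k p q := by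
  simp only [alternationCount, middleCounts]
  ring

/-! ### Generating functions -/

/-- The series `∑ F(k, p, q) (xst)^k (xt)^p x^q`. -/
def genSeries (F : ℕ → ℕ → ℕ → ℤ) : MvPowerSeries (Fin 3) ℤ := fun n =>
  if n 1 ≤ n 2 ∧ n 2 ≤ n 0 then F (n 1) (n 2 - n 1) (n 0 - n 2) else 0

theorem coeff_genSeries (F : ℕ → ℕ → ℕ → ℤ) (n : Fin 3 →₀ ℕ) :
    coeff n (genSeries F) =
      if n 1 ≤ n 2 ∧ n 2 ≤ n 0 then F (n 1) (n 2 - n 1) (n 0 - n 2) else 0 := rfl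

theorem genSeries_sub (F G : ℕ → ℕ → ℕ → ℤ) :
    genSeries (F - G) = genSeries F - genSeries G := by
  ext n
  rw [map_sub]
  simp only [coeff_genSeries, Pi.sub_apply]
  split_ifs <;> simp

theorem genSeries_add (F G : ℕ → ℕ → ℕ → ℤ) :
    genSeries (F + G) = genSeries F + genSeries G := by
  ext n
  rw [map_add]
  simp only [coeff_genSeries, Pi.add_apply]
  split_ifs <;> simp

/-- The monomial `(xst)^a (xt)^b x^c`. -/
noncomputable def shiftMonomial (a b c : ℕ) : MvPowerSeries (Fin 3) ℤ :=
  X 0 ^ (a + b + c) * X 1 ^ a * X 2 ^ (a + b)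

theorem shiftMonomial_mul_genSeries (a b c : ℕ) (F : ℕ → ℕ → ℕ → ℤ) :
    shiftMonomial a b c * genSeries F = genSeries fun k p q =>
      if a ≤ k ∧ b ≤ p ∧ c ≤ q then F (k - a) (p - b) (q - c) else 0 := by
  have hmon : shiftMonomial a b c = monomial
      (Finsupp.single 0 (a + b + c) + Finsupp.single 1 a + Finsupp.single 2 (a + b)) 1 := by
    simp only [shiftMonomial, X_pow_eq, monomial_mul_monomial, mul_one]
  ext n
  rw [hmon, coeff_monomial_mul, one_mul, coeff_genSeries, coeff_genSeries]
  have hle : (Finsupp.single 0 (a + b + c) + Finsupp.single 1 a + Finsupp.single 2 (a + b) :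
      Fin 3 →₀ ℕ) ≤ n ↔ a + b + c ≤ n 0 ∧ a ≤ n 1 ∧ a + b ≤ n 2 := by
    simp [Finsupp.le_def, Fin.forall_fin_succ]
  have h0 : (n - (Finsupp.single 0 (a + b + c) + Finsupp.single 1 a + Finsupp.single 2 (a + b) :
      Fin 3 →₀ ℕ)) 0 = n 0 - (a + b + c) := by simp
  have h1 : (n - (Finsupp.single 0 (a + b + c) + Finsupp.single 1 a + Finsupp.single 2 (a + b) :
      Fin 3 →₀ ℕ)) 1 = n 1 - a := by simp
  have h2 : (n - (Finsupp.single 0 (a + b + c) + Finsupp.single 1 a + Finsupp.single 2 (a + b) :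
      Fin 3 →₀ ℕ)) 2 = n 2 - (a + b) := by simp
  simp only [hle, h0, h1, h2]
  split_ifs <;> first | rfl | omega | skip
  congr 1 <;> omega

/-- The series `∑ G(p, q) (xt)^p x^q`. -/
def genSeries₂ (G : ℕ → ℕ → ℤ) : MvPowerSeries (Fin 3) ℤ :=
  genSeries fun k p q => if k = 0 then G p q else 0

/-- The series `∑ g(p) (xt)^p`. -/
def genSeries₁ (g : ℕ → ℤ) : MvPowerSeries (Fin 3) ℤ :=
  genSeries₂ fun p q => if q = 0 then g p else 0

theorem genSeries_eq_C (c : ℤ) :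
    genSeries₁ (fun p => if p = 0 then c else 0) = C c := by
  classical
  ext n
  rw [genSeries₁, genSeries₂, coeff_genSeries, coeff_C]
  have : n = 0 ↔ n 0 = 0 ∧ n 1 = 0 ∧ n 2 = 0 := by
    simp [Finsupp.ext_iff, Fin.forall_fin_succ]
  simp only [this]
  split_ifs <;> first | rfl | omega

theorem mul_genSeries (F : ℕ → ℕ → ℕ → ℤ)
    (hF : ∀ k p q, F (k + 2) p q = F (k + 1) p q + F k p q) :
    (1 - shiftMonomial 1 0 0 - shiftMonomial 2 0 0) * genSeries F =
      genSeries₂ (F 0) + shiftMonomial 1 0 0 * genSeries₂ (F 1 - F 0) := by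
  simp only [sub_mul, one_mul, genSeries₂, shiftMonomial_mul_genSeries]
  rw [← genSeries_sub, ← genSeries_sub, ← genSeries_add]
  congr 1
  ext k p q
  simp only [Pi.sub_apply, Pi.add_apply]
  rcases k with _ | _ | k
  · simp
  · simp
  · simp [hF]

theorem mul_genSeries₂ (G : ℕ → ℕ → ℤ) (hG : ∀ p q, G p (q + 2) = G p (q + 1) + G p q) :
    (1 - shiftMonomial 0 0 1 - shiftMonomial 0 0 2) * genSeries₂ G =
      genSeries₁ (fun p => G p 0) + shiftMonomial 0 0 1 * genSeries₁ (fun p => G p 1 - G p 0) := by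
  simp only [sub_mul, one_mul, genSeries₂, genSeries₁, shiftMonomial_mul_genSeries]
  rw [← genSeries_sub, ← genSeries_sub, ← genSeries_add]
  congr 1
  ext k p q
  simp only [Pi.sub_apply, Pi.add_apply]
  rcases k with _ | k
  · rcases q with _ | _ | q
    · simp
    · simp
    · simp [hG]
  · simp

/-- The recurrence kills all terms from degree 4 on; the `c`s are the surviving numerator
coefficients. The factor 3 is spelled as a sum so that each summand is a shift. -/
theorem mul_genSeries₁ {g : ℕ → ℤ} {c₀ c₁ c₂ c₃ : ℤ}
    (hg : ∀ p, g (p + 4) = g (p + 3) + g (p + 2) + 3 * g (p + 1) + g p)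
    (h₀ : g 0 = c₀) (h₁ : g 1 - g 0 = c₁) (h₂ : g 2 - g 1 - g 0 = c₂)
    (h₃ : g 3 - g 2 - g 1 - 3 * g 0 = c₃) :
    (1 - shiftMonomial 0 1 0 - shiftMonomial 0 2 0 -
        (shiftMonomial 0 3 0 + shiftMonomial 0 3 0 + shiftMonomial 0 3 0) -
        shiftMonomial 0 4 0) * genSeries₁ g =
      C c₀ + shiftMonomial 0 1 0 * C c₁ + shiftMonomial 0 2 0 * C c₂ +
        shiftMonomial 0 3 0 * C c₃ := by
  subst h₀ h₁ h₂ h₃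
  simp only [sub_mul, one_mul, add_mul, ← genSeries_eq_C, genSeries₂, genSeries₁,
    shiftMonomial_mul_genSeries]
  simp only [← genSeries_sub, ← genSeries_add]
  congr 1
  ext k p q
  simp only [Pi.sub_apply, Pi.add_apply]
  rcases k with _ | k
  · rcases q with _ | q
    · rcases p with _ | _ | _ | _ | p
      · simp
      · simp
      · simp
      · simp; ring
      · simp [hg]; ring
    · simp
  · simp

/-- The factor xst accounts for k = i - 1. -/
theorem alternationSeries_eq :
    alternationSeries = shiftMonomial 1 0 0 * genSeries alternationCount := by
  rw [shiftMonomial_mul_genSeries]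
  ext n
  rw [coeff_genSeries]
  change (if _ then _ else _) = _
  split_ifs <;> first | rfl | omega | skip
  rw [ncard_alternationSet (by omega) (by omega) (by omega),
    card_admissiblePerms_eq_alternationCount (by omega) (by omega) (by omega)]
  rfl

/-- The denominator-free form of the generating function identity. -/
theorem mul_alternationSeries :
    (1 - shiftMonomial 0 1 0 - shiftMonomial 0 2 0 -
        (shiftMonomial 0 3 0 + shiftMonomial 0 3 0 + shiftMonomial 0 3 0) -
        shiftMonomial 0 4 0) *
      ((1 - shiftMonomial 0 0 1 - shiftMonomial 0 0 2) *
        ((1 - shiftMonomial 1 0 0 - shiftMonomial 2 0 0) * genSeries alternationCount)) =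
    (1 + shiftMonomial 0 1 0 * 2 + shiftMonomial 0 2 0) +
      shiftMonomial 0 0 1 * (1 - shiftMonomial 0 1 0 + shiftMonomial 0 2 0 * 2 +
        shiftMonomial 0 3 0) +
      shiftMonomial 1 0 0 * (1 - shiftMonomial 0 1 0 + shiftMonomial 0 2 0 * 2 +
        shiftMonomial 0 3 0 + shiftMonomial 0 0 1 * (-1 + shiftMonomial 0 1 0 * 4 -
          shiftMonomial 0 2 0 - shiftMonomial 0 3 0)) := by
  have h00 := mul_genSeries₁ (g := fun p => alternationCount 0 p 0) (c₀ := 1) (c₁ := 2) (c₂ := 1)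
    (c₃ := 0) (fun p => alternationCount_rec_middle _ _ _) rfl rfl rfl rfl
  have h01 := mul_genSeries₁ (g := fun p => alternationCount 0 p 1 - alternationCount 0 p 0)
    (c₀ := 1) (c₁ := -1) (c₂ := 2) (c₃ := 1)
    (fun p => by simp only [alternationCount_rec_middle]; ring) rfl rfl rfl rfl
  have h10 := mul_genSeries₁ (g := fun p => (alternationCount 1 - alternationCount 0) p 0)
    (c₀ := 1) (c₁ := -1) (c₂ := 2) (c₃ := 1)
    (fun p => by simp only [Pi.sub_apply, alternationCount_rec_middle]; ring) rfl rfl rfl rfl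
  have h11 := mul_genSeries₁ (g := fun p => (alternationCount 1 - alternationCount 0) p 1 -
      (alternationCount 1 - alternationCount 0) p 0) (c₀ := -1) (c₁ := 4) (c₂ := -1) (c₃ := -1)
    (fun p => by simp only [Pi.sub_apply, alternationCount_rec_middle]; ring) rfl rfl rfl rfl
  have hl := mul_genSeries _ alternationCount_rec_left
  have hr0 := mul_genSeries₂ _ (alternationCount_rec_right 0)
  have hr1 := mul_genSeries₂ (alternationCount 1 - alternationCount 0)
    (fun p q => by simp only [Pi.sub_apply, alternationCount_rec_right]; ring)
  simp only [map_zero, map_one, map_neg, map_ofNat] at h00 h01 h10 h11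
  rw [hl, mul_add, mul_left_comm, hr0, hr1]
  linear_combination h00 + shiftMonomial 0 0 1 * h01 + shiftMonomial 1 0 0 * h10 +
    shiftMonomial 1 0 0 * shiftMonomial 0 0 1 * h11

/-! ### Nonvanishing of denominators and the identity in the field of fractions -/

theorem var_ne_zero (v : Fin 3) : var v ≠ 0 := by
  rw [var, map_ne_zero_iff _ (IsFractionRing.injective _ _)]
  intro h
  have := congrArg (coeff (Finsupp.single v 1)) h
  simp [coeff_index_single_self_X] at this

theorem algebraMap_ne_zero_of_constantCoeff_eq_one {f : MvPowerSeries (Fin 3) ℤ}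
    (hf : constantCoeff f = 1) :
    algebraMap (MvPowerSeries (Fin 3) ℤ) SeriesField f ≠ 0 := by
  rw [map_ne_zero_iff _ (IsFractionRing.injective _ _)]
  rintro rfl
  simp at hf

end TypeA

theorem mainTheorem8 (x s t : TypeA.SeriesField)
    (hx : x = TypeA.var 0) (hs : s = TypeA.var 1) (ht : t = TypeA.var 2) :
    algebraMap (MvPowerSeries (Fin 3) ℤ) TypeA.SeriesField TypeA.alternationSeries =
      1 / (t * (1 - x - x ^ 2)) *
        ((1 - x) * t * TypeA.ratH (x * t) s + TypeA.ratP (x * t) s -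
          x * s * t / (1 - x * s * t - (x * s * t) ^ 2)) := by
  have key := congrArg (algebraMap (MvPowerSeries (Fin 3) ℤ) TypeA.SeriesField)
    TypeA.mul_alternationSeries
  simp only [TypeA.shiftMonomial, map_mul, map_add, map_sub, map_pow, map_one, map_neg, map_ofNat]
    at key
  have hS := congrArg (algebraMap (MvPowerSeries (Fin 3) ℤ) TypeA.SeriesField)
    TypeA.alternationSeries_eq
  simp only [TypeA.shiftMonomial, map_mul, map_pow] at hS
  rw [← TypeA.var, ← TypeA.var, ← TypeA.var, ← hx, ← hs, ← ht] at key hS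
  have h1 : 1 - x - x ^ 2 ≠ 0 := by
    have := TypeA.algebraMap_ne_zero_of_constantCoeff_eq_one
      (f := 1 - MvPowerSeries.X 0 - MvPowerSeries.X 0 ^ 2) (by simp)
    simpa [hx, TypeA.var] using this
  have h2 : 1 - x * t - (x * t) ^ 2 - 3 * (x * t) ^ 3 - (x * t) ^ 4 ≠ 0 := by
    have := TypeA.algebraMap_ne_zero_of_constantCoeff_eq_one
      (f := 1 - MvPowerSeries.X 0 * MvPowerSeries.X 2 - (MvPowerSeries.X 0 * MvPowerSeries.X 2) ^ 2
        - 3 * (MvPowerSeries.X 0 * MvPowerSeries.X 2) ^ 3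
        - (MvPowerSeries.X 0 * MvPowerSeries.X 2) ^ 4) (by simp)
    simpa [hx, ht, TypeA.var, map_ofNat] using this
  have h3 : 1 - x * s * t - (x * s * t) ^ 2 ≠ 0 := by
    have := TypeA.algebraMap_ne_zero_of_constantCoeff_eq_one
      (f := 1 - MvPowerSeries.X 0 * MvPowerSeries.X 1 * MvPowerSeries.X 2 -
        (MvPowerSeries.X 0 * MvPowerSeries.X 1 * MvPowerSeries.X 2) ^ 2) (by simp)
    simpa [hx, hs, ht, TypeA.var] using this
  have h5 : t ≠ 0 := ht ▸ TypeA.var_ne_zero 2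
  generalize algebraMap (MvPowerSeries (Fin 3) ℤ) TypeA.SeriesField
    (TypeA.genSeries TypeA.alternationCount) = g at key hS
  have hg : g = ((1 + x * t * 2 + (x * t) ^ 2) + x * (1 - x * t + (x * t) ^ 2 * 2 + (x * t) ^ 3) +
      x * s * t * (1 - x * t + (x * t) ^ 2 * 2 + (x * t) ^ 3 +
        x * (-1 + x * t * 4 - (x * t) ^ 2 - (x * t) ^ 3))) /
      ((1 - x * t - (x * t) ^ 2 - 3 * (x * t) ^ 3 - (x * t) ^ 4) * (1 - x - x ^ 2) *
        (1 - x * s * t - (x * s * t) ^ 2)) := by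
    rw [eq_div_iff (mul_ne_zero (mul_ne_zero h2 h1) h3)]
    linear_combination key
  rw [hS, hg, TypeA.ratH, TypeA.ratP, mul_right_comm x t s]
  -- The denominators become atoms for `field_simp`. Only `D₂` is expanded again, since the last
  -- fraction on the right lacks it and picks it up as a numerator factor.
  generalize hD₁ : 1 - x - x ^ 2 = D₁ at *
  generalize hD₂ : 1 - x * t - (x * t) ^ 2 - 3 * (x * t) ^ 3 - (x * t) ^ 4 = D₂ at *
  generalize hD₃ : 1 - x * s * t - (x * s * t) ^ 2 = D₃ at *
  field_simp
  rw [← hD₂]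
  ring
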